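/- **Theorem 1 (Main Result).** Let $\mathfrak X=\{1,\dots,q\}$ be a finite alphabet and $s_{\max}\ge 0$ an integer. For distributions $p_X$ on $\mathfrak X$, $p_{Y|X}(\cdot|x)$ on $\mathfrak X$ ($x\in\mathfrak X$) and $p_S$ on $\{0,\dots,s_{\max}\}$, and integers $m\ge 1$, $n,\Lambda\ge 0$, consider the following model. The database $D^{(1)}=(X_{i,j})$ is an $m\times n$ matrix with i.i.d. entries of law $p_X$; the column repetition pattern $S^n=(S_1,\dots,S_n)$ is i.i.d. with law $p_S$; $\sigma$ is a uniformly random permutation of $[m]$; these three are independent. In the labeled correlated database $D^{(2)}$, row $\sigma(i)$ is the concatenation over $j=1,\dots,n$ (without markers) of $S_j$ noisy replicas of $X_{i,j}$, which, given $D^{(1)},S^n,\sigma$, are drawn independently of each other and of all other replicas from $p_{Y|X}(\cdot|X_{i,j})$ (the empty string if $S_j=0$). A batch of $\Lambda$ seeds is a pair $(G^{(1)},G^{(2)})$: $G^{(1)}$ is a $\Lambda\times n$ matrix with i.i.d. entries of law $p_X$, and each row of $G^{(2)}$ is obtained from the same row of $G^{(1)}$ through the same noise and the same repetition pattern $S^n$;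 given $S^n$, the seeds are independent of $(D^{(1)},D^{(2)},\sigma)$. An estimator $\hat\sigma$ maps $(D^{(1)},D^{(2)},G^{(1)},G^{(2)})$ and the sizes $m,n,\Lambda$ to a permutation of $[m]$; its error probability is $\Pr(\hat\sigma(J)\ne\sigma(J))$ with $J$ uniform on $[m]$ and independent of everything else. Then there is an estimator $\hat\sigma$, which depends on $q$ and $s_{\max}$ but not on $p_X,p_{Y|X},p_S$, with the following property. Let $p_X,p_{Y|X},p_S$ be arbitrary, let $m_n\ge1$ and $\Lambda_n\ge 0$ be integer sequences with $\lim_{n\to\infty}\frac1n\log_2 m_n=R$ and $\Lambda_n=\omega(\log n)$, and suppose $$R<I(X;Y^S\mid S),$$ where $X\sim p_X$ and $S\sim p_S$ are independent, $Y^S=(Y_1,\dots,Y_S)$ with $Y_1,Y_2,\dots$ i.i.d. of law $p_{Y|X}(\cdot|x)$ given $X=x$ (and independent of $S$), and the conditional mutual information is in bits. Then $$\lim_{n\to\infty}\Pr\bigl(\hat\sigma_n(J)\ne\sigma_n(J)\bigr)=0$$ in the model with parameters $m=m_n$, $n$, $\Lambda=\Lambda_n$; that is, every database growth rate $R<I(X;Y^S|S)$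 is achievable without knowledge of the distributions. -/

import Mathlib

open Filter Topology MeasureTheory ProbabilityTheory Asymptotics

noncomputable section

namespace DBMatch

/-- All sets of permutations are events. -/
instance permMeasurableSpace (m : ℕ) : MeasurableSpace (Equiv.Perm (Fin m)) := ⊤

/-- The joint law of one database entry `X ∼ pX` and of the noise that acts on it: given `X = x`,
the potential noisy replicas `Z 0, …, Z (smax - 1)` are i.i.d. with law `W x = p_{Y|X}(· | x)`.
If the column of the entry is repeated `s ≤ smax` times, the first `s` replicas are released. -/
def entryLaw {q : ℕ} (smax : ℕ) (pX : PMF (Fin q)) (W : Fin q → PMF (Fin q)) :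
    Measure (Fin q × (Fin smax → Fin q)) :=
  pX.toMeasure ⊗ₘ
    Kernel.ofFunOfCountable (fun x => Measure.pi (fun _ : Fin smax => (W x).toMeasure))

/-- An array of `a` rows and `n` columns: each position carries its entry and the potential noisy
replicas of this entry. -/
abbrev NoisyArray (q smax a n : ℕ) : Type := Fin a → Fin n → Fin q × (Fin smax → Fin q)

/-- Sample space: the anonymization function `σ`, the index `J` of the row at which the estimate is
tested, the column repetition pattern `S`, the database of `m` rows, and the `L` seed rows. -/
abbrev Outcome (q smax m n L : ℕ) : Type :=
  Equiv.Perm (Fin m) × Fin m × (Fin n → Fin (smax + 1)) ×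
    NoisyArray q smax m n × NoisyArray q smax L n

/-- The law of the model. All components are independent, `σ` and `J` are uniform, the `S j` are
i.i.d. with law `pS`, and the positions of the database and of the seed rows are i.i.d. with law
`entryLaw smax pX W`. -/
def modelLaw {q smax : ℕ} (pX : PMF (Fin q)) (W : Fin q → PMF (Fin q)) (pS : PMF (Fin (smax + 1)))
    (m n L : ℕ) : Measure (Outcome q smax m n L) :=
  (uniformOn (Set.univ : Set (Equiv.Perm (Fin m)))).prod <|
  (uniformOn (Set.univ : Set (Fin m))).prod <|
  (Measure.pi (fun _ : Fin n => pS.toMeasure)).prod <|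
  (Measure.pi (fun _ : Fin m => Measure.pi (fun _ : Fin n => entryLaw smax pX W))).prod <|
  (Measure.pi (fun _ : Fin L => Measure.pi (fun _ : Fin n => entryLaw smax pX W)))

/-- The unrepeated, noiseless entries of an array. -/
def clean {q smax a n : ℕ} (A : NoisyArray q smax a n) : Fin a → Fin n → Fin q :=
  fun i j => (A i j).1

/-- Row `i` after noise and column repetition: the strings consisting of the first `S j` noisy
replicas of the `j`-th entry, concatenated over the columns `j` without markers (the string is
empty if `S j = 0`). The length of the row is `∑ j, S j`, the same for all rows. -/
def repeated {q smax a n : ℕ} (S : Fin n → Fin (smax + 1)) (A : NoisyArray q smax a n) :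
    Fin a → List (Fin q) :=
  fun i => (List.finRange n).flatMap (fun j => (List.ofFn (A i j).2).take (S j))

/-- An estimator of the anonymization function over the alphabet `Fin q`: a function of the database
`D1`, the labeled correlated database `D2` and the seed matrices `G1`, `G2` (and of their sizes),
and of nothing else. -/
abbrev Estimator (q : ℕ) : Type :=
  ∀ m n L : ℕ, (Fin m → Fin n → Fin q) → (Fin m → List (Fin q)) →
    (Fin L → Fin n → Fin q) → (Fin L → List (Fin q)) → Equiv.Perm (Fin m)

/-- The error probability `Pr (σ̂ J ≠ σ J)`. The row `σ i` of the labeled correlated database is the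
noisy and repeated version of the row `i` of the database; the seed rows share the repetition
pattern `S` and are given in matching order. -/
def errorProb {q smax : ℕ} (est : Estimator q)
    (pX : PMF (Fin q)) (W : Fin q → PMF (Fin q)) (pS : PMF (Fin (smax + 1))) (m n L : ℕ) : ℝ :=
  (modelLaw pX W pS m n L).real
    {(σ, J, S, D, G) : Outcome q smax m n L |
      est m n L (clean D) (fun k => repeated S D (σ.symm k)) (clean G) (repeated S G) J ≠ σ J}

/-- The mutual information (in bits) of a pair with joint probability mass function `p`. -/
def mutualInfo {A B : Type} [Fintype A] [Fintype B] (p : A → B → ℝ) : ℝ :=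
  ∑ a, ∑ b, p a b * Real.logb 2 (p a b / ((∑ b', p a b') * (∑ a', p a' b)))

/-- `I(X; Y^S | S)` in bits, the average over `S = s` of the mutual information of `X` and
`Y^s = (Y 0, …, Y (s - 1))`, where `X ∼ pX` is independent of `S ∼ pS` and the `Y l` are i.i.d. with
law `W x` given `X = x`. -/
def condMutualInfo {q smax : ℕ} (pX : PMF (Fin q)) (W : Fin q → PMF (Fin q))
    (pS : PMF (Fin (smax + 1))) : ℝ :=
  ∑ s : Fin (smax + 1), (pS s).toReal *
    mutualInfo (fun (x : Fin q) (y : Fin s → Fin q) => (pX x).toReal * ∏ l, (W x (y l)).toReal)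

end DBMatch

end

namespace DBMatch

/-! ### Product measures -/

section Product

variable {Ω : Type*} [MeasurableSpace Ω]

/-- One-sided Hoeffding inequality for sums of i.i.d. bounded functions under a product measure. -/
lemma pi_hoeffding (μ : Measure Ω) [IsProbabilityMeasure μ] (n : ℕ) (f : Ω → ℝ)
    (hf : Measurable f) {a : ℝ} (hb : ∀ ω, f ω ∈ Set.Icc a (a + 1)) {t : ℝ} (ht : 0 ≤ t) :
    (Measure.pi fun _ : Fin n => μ).real {ω | t ≤ ∑ j, (f (ω j) - ∫ x, f x ∂μ)} ≤
      Real.exp (-2 * t ^ 2 / n) := by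
  have hind : iIndepFun (fun (i : Fin n) (ω : Fin n → Ω) => f (ω i) - ∫ x, f x ∂μ)
      (Measure.pi fun _ : Fin n => μ) :=
    iIndepFun_pi (μ := fun _ : Fin n => μ) (X := fun _ x => f x - ∫ x, f x ∂μ)
      (fun _ => (hf.sub_const _).aemeasurable)
  have h1 : HasSubgaussianMGF (fun x => f x - ∫ x, f x ∂μ) ((‖(a + 1) - a‖₊ / 2) ^ 2) μ :=
    hasSubgaussianMGF_of_mem_Icc hf.aemeasurable (ae_of_all _ hb)
  have hsub : ∀ i ∈ (Finset.univ : Finset (Fin n)),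
      HasSubgaussianMGF (fun ω : Fin n → Ω => f (ω i) - ∫ x, f x ∂μ)
        ((‖(a + 1) - a‖₊ / 2) ^ 2) (Measure.pi fun _ : Fin n => μ) := by
    intro i _
    have hm := measurePreserving_eval (fun _ : Fin n => μ) i
    refine HasSubgaussianMGF.of_map (X := fun x => f x - ∫ x, f x ∂μ) (Y := Function.eval i)
      hm.measurable.aemeasurable ?_
    rw [hm.map_eq]; exact h1
  refine (HasSubgaussianMGF.measure_sum_ge_le_of_iIndepFun hind hsub ht).trans (le_of_eq ?_)
  congr 1
  simp only [add_sub_cancel_left, nnnorm_one, Finset.sum_const, Finset.card_univ, Fintype.card_fin,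
    nsmul_eq_mul]
  push_cast
  rcases Nat.eq_zero_or_pos n with rfl | hn
  · simp
  · field_simp

open Classical in
/-- Hoeffding's inequality for the number of coordinates in a given event. -/
lemma pi_count_deviation (μ : Measure Ω) [IsProbabilityMeasure μ] (n : ℕ) {A : Set Ω}
    (hA : MeasurableSet A) {t : ℝ} (ht : 0 ≤ t) :
    (Measure.pi fun _ : Fin n => μ).real
      {ω | t < |((Finset.univ.filter fun j => ω j ∈ A).card : ℝ) - n * μ.real A|} ≤
      2 * Real.exp (-2 * t ^ 2 / n) := by
  have hc : ∀ ω : Fin n → Ω, ((Finset.univ.filter fun j => ω j ∈ A).card : ℝ) - n * μ.real A =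
      ∑ j, (A.indicator (fun _ => (1 : ℝ)) (ω j) - ∫ x, A.indicator (fun _ => (1 : ℝ)) x ∂μ) := by
    intro ω
    rw [Finset.sum_sub_distrib, integral_indicator_const _ hA]
    simp [Set.indicator_apply]
  have hi : ∫ x, -A.indicator (fun _ => (1 : ℝ)) x ∂μ
      = -∫ x, A.indicator (fun _ => (1 : ℝ)) x ∂μ := integral_neg _
  have hmeas : Measurable (A.indicator (fun _ => (1 : ℝ))) := measurable_const.indicator hA
  have h1 := pi_hoeffding μ n (A.indicator (fun _ => (1 : ℝ))) hmeas (a := 0)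
    (fun ω => by by_cases h : ω ∈ A <;> simp [h]) ht
  have h2 := pi_hoeffding μ n (fun x => -A.indicator (fun _ => (1 : ℝ)) x) hmeas.neg (a := -1)
    (fun ω => by by_cases h : ω ∈ A <;> simp [h]) ht
  rw [two_mul]
  refine le_trans (le_trans (measureReal_mono ?_) (measureReal_union_le _ _)) (add_le_add h1 h2)
  intro ω hω
  simp only [Set.mem_ofPred_eq, hc] at hω
  rcases lt_abs.1 hω with h | h
  · exact Or.inl h.le
  · refine Or.inr (h.le.trans_eq ?_)
    rw [hi, ← Finset.sum_neg_distrib]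
    exact Finset.sum_congr rfl fun j _ => by ring

/-- Chernoff bound for products of i.i.d. nonnegative functions under a product measure. -/
lemma pi_prod_ge_le (μ : Measure Ω) [IsProbabilityMeasure μ] [Finite Ω]
    [MeasurableSingletonClass Ω] (n : ℕ) {g : Ω → ℝ} (hg : ∀ ω, 0 ≤ g ω) {c : ℝ} (hc : 0 < c) :
    (Measure.pi fun _ : Fin n => μ).real {ω | c ≤ ∏ j, g (ω j)} ≤ (∫ x, g x ∂μ) ^ n / c := by
  rw [le_div_iff₀ hc, mul_comm]
  have h := mul_meas_ge_le_integral_of_nonneg (μ := Measure.pi fun _ : Fin n => μ)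
    (f := fun ω => ∏ j, g (ω j)) (ae_of_all _ fun ω => Finset.prod_nonneg fun j _ => hg _)
    Integrable.of_finite c
  rwa [integral_fintype_prod_eq_pow, Fintype.card_fin] at h

/-- Two distinct coordinates of a product measure with equal factors. -/
lemma measurePreserving_eval_pair (μ : Measure Ω) [IsProbabilityMeasure μ] {ι : Type*} [Fintype ι]
    {i k : ι} (h : i ≠ k) :
    MeasurePreserving (fun ω : ι → Ω => (ω i, ω k)) (Measure.pi fun _ => μ) (μ.prod μ) := by
  have hind : iIndepFun (fun (i : ι) (ω : ι → Ω) => ω i) (Measure.pi fun _ : ι => μ) :=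
    iIndepFun_pi (μ := fun _ : ι => μ) (X := fun _ x => x) (fun _ => aemeasurable_id)
  have h2 := hind.indepFun h
  refine ⟨(measurable_pi_apply i).prodMk (measurable_pi_apply k), ?_⟩
  rw [(indepFun_iff_map_prod_eq_prod_map_map (measurable_pi_apply i).aemeasurable
    (measurable_pi_apply k).aemeasurable).1 h2]
  congr 1
  · exact (measurePreserving_eval (fun _ : ι => μ) i).map_eq
  · exact (measurePreserving_eval (fun _ : ι => μ) k).map_eq

/-- Zipping two independent i.i.d. sequences. -/
lemma measurePreserving_zip {Ω' : Type*} [MeasurableSpace Ω'] (μ : Measure Ω) (ν : Measure Ω')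
    [IsProbabilityMeasure μ] [IsProbabilityMeasure ν] (n : ℕ) :
    MeasurePreserving (fun (p : (Fin n → Ω) × (Fin n → Ω')) j => (p.1 j, p.2 j))
      ((Measure.pi fun _ => μ).prod (Measure.pi fun _ => ν)) (Measure.pi fun _ => μ.prod ν) :=
  (measurePreserving_arrowProdEquivProdArrow Ω Ω' (Fin n) (fun _ => μ) (fun _ => ν)).symm

end Product

/-! ### The law of an entry and of its replicas -/

section Entry

variable {q smax : ℕ} (pX : PMF (Fin q)) (W : Fin q → PMF (Fin q))

instance (x : Fin q) : IsProbabilityMeasure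
    (Measure.pi (fun _ : Fin smax => (W x).toMeasure)) := inferInstance

instance : IsMarkovKernel (Kernel.ofFunOfCountable
    (fun x => Measure.pi (fun _ : Fin smax => (W x).toMeasure))) :=
  ⟨fun x => by change IsProbabilityMeasure (Measure.pi _); infer_instance⟩

instance : IsProbabilityMeasure (entryLaw smax pX W) := by
  unfold entryLaw; infer_instance

lemma entryLaw_real_singleton (x : Fin q) (z : Fin smax → Fin q) :
    (entryLaw smax pX W).real {(x, z)} = (pX x).toReal * ∏ l, (W x (z l)).toReal := by
  rw [← Set.singleton_prod_singleton, measureReal_def, entryLaw,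
    Measure.compProd_apply_prod (measurableSet_singleton _) (measurableSet_singleton _),
    lintegral_singleton]
  change (Measure.pi (fun _ : Fin smax => (W x).toMeasure) {z} * _).toReal = _
  rw [Measure.pi_singleton, ENNReal.toReal_mul, ENNReal.toReal_prod, mul_comm]
  simp

lemma integral_entryLaw (f : Fin q × (Fin smax → Fin q) → ℝ) :
    ∫ e, f e ∂(entryLaw smax pX W) =
      ∑ x, ∑ z : Fin smax → Fin q, (pX x).toReal * (∏ l, (W x (z l)).toReal) * f (x, z) := by
  rw [integral_fintype Integrable.of_finite, Fintype.sum_prod_type]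
  simp [entryLaw_real_singleton]

lemma pmf_toReal_sum {α : Type*} [Fintype α] (p : PMF α) : ∑ a, (p a).toReal = 1 := by
  have h := p.tsum_coe
  rw [tsum_fintype] at h
  rw [← ENNReal.toReal_sum (fun a _ => p.apply_ne_top a), h, ENNReal.toReal_one]

lemma integral_pmf {α : Type*} [Fintype α] [MeasurableSpace α] [MeasurableSingletonClass α]
    (p : PMF α) (f : α → ℝ) : ∫ a, f a ∂p.toMeasure = ∑ a, (p a).toReal * f a := by
  rw [integral_fintype Integrable.of_finite]
  simp only [measureReal_def, PMF.toMeasure_apply_singleton _ _ (measurableSet_singleton _),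
    smul_eq_mul]

/-- Marginalizing a sum over `N`-tuples to the first `s` coordinates. -/
lemma sum_prod_take {α : Type*} [Fintype α] {w : α → ℝ} (hw : ∑ a, w a = 1) :
    ∀ (N s : ℕ) (_ : s ≤ N) (h : List α → ℝ),
      ∑ z : Fin N → α, (∏ l, w (z l)) * h ((List.ofFn z).take s) =
        ∑ y : Fin s → α, (∏ l, w (y l)) * h (List.ofFn y)
  | N, 0, _, h => by
    have h1 : ∑ z : Fin N → α, ∏ l, w (z l) = 1 := by
      rw [← Fintype.prod_sum (fun (_ : Fin N) a => w a)]; simp [hw]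
    simp [← Finset.sum_mul, h1]
  | 0, s + 1, hs, _ => by omega
  | N + 1, s + 1, hs, h => by
    rw [← (Fin.consEquiv (fun _ : Fin (N + 1) => α)).sum_comp,
      ← (Fin.consEquiv (fun _ : Fin (s + 1) => α)).sum_comp, Fintype.sum_prod_type,
      Fintype.sum_prod_type]
    refine Finset.sum_congr rfl fun a _ => ?_
    have ih := sum_prod_take hw N s (by omega) (fun b => h (a :: b))
    simp only [Fin.consEquiv_apply, Fin.prod_univ_succ, Fin.cons_zero, Fin.cons_succ,
      List.ofFn_succ, List.take_succ_cons, mul_assoc, ← Finset.mul_sum] at ih ⊢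
    rw [ih]

end Entry

/-! ### The estimator -/

section Estimator

variable {q m n L : ℕ}

open Classical in
/-- The frequency of the symbol pair `(x, y)` in the column `j` of the first seed matrix and the
column `k` of the second one. -/
noncomputable def seedFreq (G1 : Fin L → Fin n → Fin q) (G2 : Fin L → List (Fin q))
    (j : Fin n) (k : ℕ) (x y : Fin q) : ℝ :=
  ((Finset.univ.filter fun r => G1 r j = x ∧ (G2 r)[k]? = some y).card : ℝ) / L

/-- The tolerance for the seed frequencies. -/
noncomputable def seedTol (n L : ℕ) : ℝ := √(√(Real.log n / L))

/-- The columns `j` and `k` of the two seed matrices look dependent: their joint frequencies differ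
from the products of their marginals. -/
def Linked (G1 : Fin L → Fin n → Fin q) (G2 : Fin L → List (Fin q)) (j : Fin n) (k : ℕ) : Prop :=
  ∃ x y, (1 + q : ℝ) ^ 2 * seedTol n L <
    |seedFreq G1 G2 j k x y - (∑ y', seedFreq G1 G2 j k x y') * ∑ x', seedFreq G1 G2 j k x' y|

open Classical in
/-- The entries of a row of the labeled database in the columns linked to the column `j`. -/
noncomputable def block (G1 : Fin L → Fin n → Fin q) (G2 : Fin L → List (Fin q)) (j : Fin n)
    (row : List (Fin q)) : List (Fin q) :=
  ((List.range row.length).filter fun k => decide (Linked G1 G2 j k)).filterMap (row[·]?)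

open Classical in
/-- The number of positions of a sequence where `φ` takes the value `a`. -/
noncomputable def valueCount {T B : Type*} (φ : T → B) (t : Fin n → T) (a : B) : ℕ :=
  (Finset.univ.filter fun j => φ (t j) = a).card

/-- The number of columns with entry `a.1` in the row `x` and with replicas `a.2` in the row
`row`. -/
noncomputable def letterCount (G1 : Fin L → Fin n → Fin q) (G2 : Fin L → List (Fin q))
    (x : Fin n → Fin q) (row : List (Fin q)) (a : Fin q × List (Fin q)) : ℕ :=
  valueCount (fun j => (x j, block G1 G2 j row)) id a

/-- The tolerance for the letter counts. -/
noncomputable def countTol (n : ℕ) : ℝ := √(n * √n)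

/-- The row `i` of the first database and the row `k` of the second one have about the same letter
counts as the first pair of seed rows. -/
def Similar (D1 : Fin m → Fin n → Fin q) (D2 : Fin m → List (Fin q))
    (G1 : Fin L → Fin n → Fin q) (G2 : Fin L → List (Fin q)) (i k : Fin m) : Prop :=
  ∃ r : Fin L, r.val = 0 ∧ ∀ a, |(letterCount G1 G2 (D1 i) (D2 k) a : ℝ) -
    letterCount G1 G2 (G1 r) (G2 r) a| ≤ countTol n

/-- A relation on a finite type, restricted to the pairs without any competitor, extends to a
permutation. -/
lemma exists_perm_of_unique {α : Type*} [Finite α] (r : α → α → Prop) :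
    ∃ σ : Equiv.Perm α, ∀ i k, r i k → (∀ i', r i' k → i' = i) → (∀ k', r i k' → k' = k) →
      σ i = k := by
  classical
  let u : α → α → Prop := fun i k => r i k ∧ (∀ i', r i' k → i' = i) ∧ ∀ k', r i k' → k' = k
  let f : {i // ∃ k, u i k} → {k // ∃ i, u i k} := fun i => ⟨i.2.choose, i.1, i.2.choose_spec⟩
  have hf : Function.Bijective f := by
    constructor
    · intro i i' h
      have h' : i.2.choose = i'.2.choose := congrArg Subtype.val h
      exact Subtype.ext (i'.2.choose_spec.2.1 _ (h' ▸ i.2.choose_spec.1))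
    · rintro ⟨k, i, h⟩
      exact ⟨⟨i, k, h⟩, Subtype.ext (h.2.2 _ (Exists.choose_spec (⟨k, h⟩ : ∃ k, u i k)).1)⟩
  refine ⟨(Equiv.ofBijective f hf).extendSubtype, fun i k h1 h2 h3 => ?_⟩
  have hi : ∃ k, u i k := ⟨k, h1, h2, h3⟩
  refine (Equiv.extendSubtype_apply_of_mem (Equiv.ofBijective f hf) i hi).trans ?_
  exact h3 _ hi.choose_spec.1

/-- The estimator: match the rows that are similar to each other and to no other row. -/
noncomputable def estimator (q : ℕ) : Estimator q := fun _ _ _ D1 D2 G1 G2 =>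
  (exists_perm_of_unique (Similar D1 D2 G1 G2)).choose

end Estimator

/-! ### Recovering the blocks -/

section Blocks

variable {q smax a n : ℕ}

/-- The positions of an array that are released under the repetition pattern `S`. -/
def releasedIndices (S : Fin n → Fin (smax + 1)) : List (Fin n × Fin smax) :=
  (List.finRange n).flatMap fun j => ((List.finRange smax).take (S j)).map (Prod.mk j)

lemma repeated_eq_map (S : Fin n → Fin (smax + 1)) (A : NoisyArray q smax a n) (i : Fin a) :
    repeated S A i = (releasedIndices S).map fun p => (A i p.1).2 p.2 := by
  simp only [repeated, releasedIndices, List.map_flatMap, List.map_map, List.ofFn_eq_map,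
    List.map_take]
  rfl

lemma filter_releasedIndices (S : Fin n → Fin (smax + 1)) (j : Fin n) :
    (releasedIndices S).filter (fun p => decide (p.1 = j)) =
      ((List.finRange smax).take (S j)).map (Prod.mk j) := by
  have key : ∀ l : List (Fin n), l.Nodup →
      (l.flatMap fun i => ((List.finRange smax).take (S i)).map (Prod.mk i)).filter
        (fun p => decide (p.1 = j)) =
      if j ∈ l then ((List.finRange smax).take (S j)).map (Prod.mk j) else [] := by
    intro l
    induction l with
    | nil => simp
    | cons i l ih =>
      intro hl
      rw [List.nodup_cons] at hl
      rw [List.flatMap_cons, List.filter_append, ih hl.2, List.filter_map]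
      by_cases h : i = j
      · subst h
        simp [hl.1, Function.comp_def]
      · simp [h, Ne.symm h, Function.comp_def]
  simpa [releasedIndices] using key _ (List.nodup_finRange n)

lemma filterMap_filter_range {α β : Type*} (l : List α) (f : α → β) (p : ℕ → Bool) (r : α → Bool)
    (h : ∀ k (hk : k < l.length), p k = r l[k]) :
    ((List.range (l.map f).length).filter p).filterMap ((l.map f)[·]?) = (l.filter r).map f := by
  induction l generalizing p with
  | nil => simp
  | cons b l ih =>
    have h0 := h 0 (by simp)
    have ih' := ih (fun k => p (k + 1)) (fun k hk => h (k + 1) (by simpa using hk))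
    simp only [List.length_map, List.length_cons, List.map_cons, List.range_succ_eq_map,
      List.filter_cons, List.filter_map] at ih' ⊢
    simp only [List.getElem_cons_zero] at h0
    rw [h0]
    cases r b <;>
    · simp only [Bool.false_eq_true, if_true, if_false, List.filterMap_cons, List.filterMap_map,
        List.getElem?_cons_zero, List.map_cons, Function.comp_def, List.getElem?_cons_succ]
      simpa [Function.comp_def] using ih'

/-- The letter of a column that is repeated `s` times and has entry `x` and potential replicas
`z`. -/
def letter (s : Fin (smax + 1)) (e : Fin q × (Fin smax → Fin q)) : Fin q × List (Fin q) :=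
  (e.1, (List.ofFn e.2).take s)

lemma block_repeated {L : ℕ} {G1 : Fin L → Fin n → Fin q} {G2 : Fin L → List (Fin q)}
    (S : Fin n → Fin (smax + 1))
    (h : ∀ j k (hk : k < (releasedIndices S).length),
      Linked G1 G2 j k ↔ ((releasedIndices S)[k]).1 = j)
    (A : NoisyArray q smax a n) (i : Fin a) (j : Fin n) :
    block G1 G2 j (repeated S A i) = (List.ofFn (A i j).2).take (S j) := by
  classical
  rw [block, repeated_eq_map, filterMap_filter_range _ _ _ (fun p => decide (p.1 = j)) ?_,
    filter_releasedIndices, List.map_map, List.ofFn_eq_map, List.map_take]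
  · rfl
  · intro k hk
    simp [h j k hk]

end Blocks

/-! ### Detection of the repetition pattern -/

section Detection

variable {q smax n L : ℕ}

open Classical in
/-- The frequency with which, over the rows of the array `G`, the entry at `j` is `x` and the
potential replica at `p` is `y`. -/
noncomputable def arrayFreq (G : NoisyArray q smax L n) (j : Fin n) (p : Fin n × Fin smax)
    (x y : Fin q) : ℝ :=
  ((Finset.univ.filter fun r => (G r j).1 = x ∧ (G r p.1).2 p.2 = y).card : ℝ) / L

lemma seedFreq_clean_repeated (S : Fin n → Fin (smax + 1)) (G : NoisyArray q smax L n) (j : Fin n)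
    {k : ℕ} (hk : k < (releasedIndices S).length) (x y : Fin q) :
    seedFreq (clean G) (repeated S G) j k x y = arrayFreq G j (releasedIndices S)[k] x y := by
  unfold seedFreq arrayFreq
  congr 3
  ext r
  simp [repeated_eq_map, clean, List.getElem?_eq_getElem hk]

/-- The law of the output symbol. -/
noncomputable def outLaw (pX : PMF (Fin q)) (W : Fin q → PMF (Fin q)) (y : Fin q) : ℝ :=
  ∑ x, (pX x).toReal * (W x y).toReal

/-- The joint law of the entry at `j` and of a potential replica at the column `j'`. -/
noncomputable def pairLaw (pX : PMF (Fin q)) (W : Fin q → PMF (Fin q)) (j j' : Fin n)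
    (x y : Fin q) : ℝ :=
  if j' = j then (pX x).toReal * (W x y).toReal else (pX x).toReal * outLaw pX W y

lemma pmf_toReal_nonneg_le_one {α : Type*} (p : PMF α) (a : α) :
    0 ≤ (p a).toReal ∧ (p a).toReal ≤ 1 :=
  ⟨ENNReal.toReal_nonneg, ENNReal.toReal_le_of_le_ofReal zero_le_one (by simpa using p.coe_le_one a)⟩

lemma sum_outLaw (pX : PMF (Fin q)) (W : Fin q → PMF (Fin q)) : ∑ y, outLaw pX W y = 1 := by
  unfold outLaw
  rw [Finset.sum_comm]
  simp [← Finset.mul_sum, pmf_toReal_sum]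

lemma outLaw_nonneg (pX : PMF (Fin q)) (W : Fin q → PMF (Fin q)) (y : Fin q) :
    0 ≤ outLaw pX W y :=
  Finset.sum_nonneg fun _ _ => mul_nonneg ENNReal.toReal_nonneg ENNReal.toReal_nonneg

lemma outLaw_le_one (pX : PMF (Fin q)) (W : Fin q → PMF (Fin q)) (y : Fin q) :
    outLaw pX W y ≤ 1 := by
  rw [← sum_outLaw pX W]
  exact Finset.single_le_sum (fun y _ => outLaw_nonneg pX W y) (Finset.mem_univ y)

lemma sum_pairLaw_right (pX : PMF (Fin q)) (W : Fin q → PMF (Fin q)) (j j' : Fin n) (x : Fin q) :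
    ∑ y, pairLaw pX W j j' x y = (pX x).toReal := by
  unfold pairLaw
  split_ifs <;> simp [← Finset.mul_sum, pmf_toReal_sum, sum_outLaw]

lemma sum_pairLaw_left (pX : PMF (Fin q)) (W : Fin q → PMF (Fin q)) (j j' : Fin n) (y : Fin q) :
    ∑ x, pairLaw pX W j j' x y = outLaw pX W y := by
  unfold pairLaw
  split_ifs
  · rfl
  · simp [← Finset.sum_mul, pmf_toReal_sum]

lemma abs_mul_sub_mul_le {b c b' c' B C : ℝ} (hb : |b - b'| ≤ B) (hc : |c - c'| ≤ C)
    (hb' : |b'| ≤ 1) (hc' : |c'| ≤ 1) : |b * c - b' * c'| ≤ B * C + B + C := by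
  have : b * c - b' * c' = (b - b') * (c - c') + (b - b') * c' + b' * (c - c') := by ring
  rw [this]
  have hB : 0 ≤ B := (abs_nonneg _).trans hb
  have hC : 0 ≤ C := (abs_nonneg _).trans hc
  refine (abs_add_three _ _ _).trans ?_
  rw [abs_mul, abs_mul, abs_mul]
  have h1 := mul_le_mul hb hc (abs_nonneg _) hB
  have h2 := mul_le_mul hb hc' (abs_nonneg _) hB
  have h3 := mul_le_mul hb' hc (abs_nonneg _) zero_le_one
  linarith

/-- If all frequencies are close to their probabilities, the linked columns are the right ones. -/
lemma linked_iff {pX : PMF (Fin q)} {W : Fin q → PMF (Fin q)} {S : Fin n → Fin (smax + 1)}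
    {G : NoisyArray q smax L n} (hδ : seedTol n L ≤ 1)
    (hG : ∀ j p x y, |arrayFreq G j p x y - pairLaw pX W j p.1 x y| ≤ seedTol n L)
    (hd : ∃ x y, 2 * ((1 + q : ℝ) ^ 2 * seedTol n L) <
      |(pX x).toReal * (W x y).toReal - (pX x).toReal * outLaw pX W y|)
    (j : Fin n) (k : ℕ) (hk : k < (releasedIndices S).length) :
    Linked (clean G) (repeated S G) j k ↔ ((releasedIndices S)[k]).1 = j := by
  have h0 : 0 ≤ seedTol n L := Real.sqrt_nonneg _
  unfold Linked
  simp only [seedFreq_clean_repeated S G j hk]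
  set p := (releasedIndices S)[k]
  set δ := seedTol n L
  have hdev : ∀ x y, |(arrayFreq G j p x y - (∑ y', arrayFreq G j p x y') *
      ∑ x', arrayFreq G j p x' y) - (pairLaw pX W j p.1 x y - (pX x).toReal * outLaw pX W y)| ≤
        (1 + q : ℝ) ^ 2 * δ := by
    intro x y
    have hb : |(∑ y', arrayFreq G j p x y') - (pX x).toReal| ≤ q * δ := by
      rw [← sum_pairLaw_right pX W j p.1 x, ← Finset.sum_sub_distrib]
      refine (Finset.abs_sum_le_sum_abs _ _).trans ((Finset.sum_le_sum fun y' _ => hG j p x y').trans ?_)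
      simp
    have hc : |(∑ x', arrayFreq G j p x' y) - outLaw pX W y| ≤ q * δ := by
      rw [← sum_pairLaw_left pX W j p.1 y, ← Finset.sum_sub_distrib]
      refine (Finset.abs_sum_le_sum_abs _ _).trans ((Finset.sum_le_sum fun x' _ => hG j p x' y).trans ?_)
      simp
    have hm := abs_mul_sub_mul_le hb hc
      (by rw [abs_of_nonneg (pmf_toReal_nonneg_le_one pX x).1]; exact (pmf_toReal_nonneg_le_one pX x).2)
      (by rw [abs_of_nonneg (outLaw_nonneg pX W y)]; exact outLaw_le_one pX W y)
    have hm' : (q * δ) * (q * δ) ≤ q ^ 2 * δ := by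
      have : δ * δ ≤ δ := mul_le_of_le_one_left h0 hδ
      nlinarith [sq_nonneg (q : ℝ)]
    rw [sub_sub_sub_comm]
    refine (abs_sub _ _).trans ?_
    have := hG j p x y
    nlinarith
  constructor
  · rintro ⟨x, y, h⟩
    by_contra hne
    have := hdev x y
    rw [pairLaw, if_neg hne, sub_self, sub_zero] at this
    exact absurd h (not_lt.2 this)
  · intro he
    obtain ⟨x, y, h⟩ := hd
    refine ⟨x, y, ?_⟩
    have := hdev x y
    rw [pairLaw, if_pos he] at this
    have h2 := abs_sub_abs_le_abs_sub ((pX x).toReal * (W x y).toReal - (pX x).toReal * outLaw pX W y)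
      (arrayFreq G j p x y - (∑ y', arrayFreq G j p x y') * ∑ x', arrayFreq G j p x' y)
    rw [abs_sub_comm] at this
    linarith

end Detection

/-! ### Types and likelihood ratios -/

section Types

variable {T B : Type*} {n : ℕ}

open Classical in
/-- The set of values of a function on a finite type. -/
noncomputable def values [Fintype T] (φ : T → B) : Finset B := Finset.univ.image φ

lemma valueCount_eq_zero {φ : T → B} {a : B} (ha : a ∉ Set.range φ) (t : Fin n → T) :
    valueCount φ t a = 0 := by
  classical
  rw [valueCount, Finset.card_eq_zero, Finset.filter_eq_empty_iff]
  exact fun j _ h => ha ⟨_, h⟩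

variable [Fintype T] [MeasurableSpace T] [MeasurableSingletonClass T]

open Classical in
/-- If the empirical distribution of `φ` is close to its law, then the empirical mean of `v ∘ φ` is
close to its expectation. -/
lemma sum_ge_of_valueCount (μ : Measure T) [IsProbabilityMeasure μ] (φ : T → B) (v : B → ℝ)
    (t : Fin n → T) {K : ℝ}
    (h : ∀ a, |(valueCount φ t a : ℝ) - n * μ.real (φ ⁻¹' {a})| ≤ K) :
    n * ∫ x, v (φ x) ∂μ - K * ∑ a ∈ values φ, |v a| ≤ ∑ j, v (φ (t j)) := by
  have h1 : ∑ j, v (φ (t j)) = ∑ a ∈ Finset.univ.image φ, (valueCount φ t a : ℝ) * v a := by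
    rw [← Finset.sum_fiberwise_of_maps_to (t := Finset.univ.image φ) (g := fun j => φ (t j))
      (fun j _ => Finset.mem_image_of_mem _ (Finset.mem_univ _))]
    refine Finset.sum_congr rfl fun a _ => ?_
    rw [Finset.sum_congr rfl (g := fun _ => v a) (fun j hj => by rw [(Finset.mem_filter.1 hj).2]),
      Finset.sum_const, nsmul_eq_mul, valueCount]
  have h2 : ∫ x, v (φ x) ∂μ = ∑ a ∈ Finset.univ.image φ, μ.real (φ ⁻¹' {a}) * v a := by
    rw [integral_fintype Integrable.of_finite,
      ← Finset.sum_fiberwise_of_maps_to (t := Finset.univ.image φ) (g := φ)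
      (fun j _ => Finset.mem_image_of_mem _ (Finset.mem_univ _))]
    refine Finset.sum_congr rfl fun a _ => ?_
    rw [Finset.sum_congr rfl (g := fun x => μ.real {x} * v a)
      (fun j hj => by rw [(Finset.mem_filter.1 hj).2, smul_eq_mul]), ← Finset.sum_mul,
      sum_measureReal_singleton]
    congr 2
    ext; simp
  rw [h1, h2, values, Finset.mul_sum, Finset.mul_sum, ← Finset.sum_sub_distrib]
  refine Finset.sum_le_sum fun a _ => ?_
  have := mul_le_mul_of_nonneg_right (h a) (abs_nonneg (v a))
  rw [← abs_mul] at this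
  have := neg_le_of_abs_le this
  linarith

open Classical in
/-- The empirical distribution of `φ` is close to its law with high probability. -/
lemma measure_valueCount_deviation (μ : Measure T) [IsProbabilityMeasure μ] (φ : T → B) {K : ℝ}
    (hK : 0 ≤ K) :
    (Measure.pi fun _ : Fin n => μ).real
      {t | ¬ ∀ a, |(valueCount φ t a : ℝ) - n * μ.real (φ ⁻¹' {a})| ≤ K} ≤
      (values φ).card * (2 * Real.exp (-2 * K ^ 2 / n)) := by
  have hsub : {t : Fin n → T | ¬ ∀ a, |(valueCount φ t a : ℝ) - n * μ.real (φ ⁻¹' {a})| ≤ K} ⊆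
      ⋃ a ∈ Finset.univ.image φ, {t : Fin n → T |
        K < |((Finset.univ.filter fun j => t j ∈ φ ⁻¹' {a}).card : ℝ) - n * μ.real (φ ⁻¹' {a})|} := by
    intro t ht
    simp only [Set.mem_ofPred_eq, not_forall, not_le] at ht
    obtain ⟨a, ha⟩ := ht
    by_cases hr : a ∈ Set.range φ
    · simp only [Set.mem_iUnion]
      refine ⟨a, by simpa using hr, ?_⟩
      exact ha
    · rw [valueCount_eq_zero hr, Set.preimage_singleton_eq_empty.2 hr] at ha
      simp at ha
      exact absurd hK (not_le.2 ha)
  refine (measureReal_mono hsub (measure_ne_top _ _)).trans ((measureReal_biUnion_finset_le _ _).trans ?_)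
  refine (Finset.sum_le_card_nsmul _ _ _ fun a _ =>
    pi_count_deviation μ n (Set.toFinite (φ ⁻¹' {a})).measurableSet hK).trans (by rw [nsmul_eq_mul, values])

end Types

section Ratio

variable {q smax : ℕ} (pX : PMF (Fin q)) (W : Fin q → PMF (Fin q))

/-- The joint law of an entry and its block of replicas, given the length of the block. -/
noncomputable def jointLaw (a : Fin q × List (Fin q)) : ℝ :=
  (pX a.1).toReal * (a.2.map fun y => (W a.1 y).toReal).prod

/-- The law of a block of replicas, given its length. -/
noncomputable def blockLaw (b : List (Fin q)) : ℝ := ∑ x, jointLaw pX W (x, b)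

/-- The likelihood ratio of a letter, with the value `η` in place of zero. -/
noncomputable def ratio (η : ℝ) (a : Fin q × List (Fin q)) : ℝ :=
  if jointLaw pX W a = 0 then η else jointLaw pX W a / ((pX a.1).toReal * blockLaw pX W a.2)

lemma jointLaw_nonneg (a : Fin q × List (Fin q)) : 0 ≤ jointLaw pX W a := by
  refine mul_nonneg ENNReal.toReal_nonneg (List.prod_nonneg ?_)
  intro c hc
  obtain ⟨y, -, rfl⟩ := List.mem_map.1 hc
  exact ENNReal.toReal_nonneg

lemma jointLaw_le_blockLaw (a : Fin q × List (Fin q)) : jointLaw pX W a ≤ blockLaw pX W a.2 :=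
  Finset.single_le_sum (f := fun x => jointLaw pX W (x, a.2))
    (fun x _ => jointLaw_nonneg pX W (x, a.2)) (Finset.mem_univ a.1)

lemma blockLaw_nonneg (b : List (Fin q)) : 0 ≤ blockLaw pX W b :=
  Finset.sum_nonneg fun x _ => jointLaw_nonneg pX W (x, b)

lemma ratio_pos {η : ℝ} (hη : 0 < η) (a : Fin q × List (Fin q)) : 0 < ratio pX W η a := by
  unfold ratio
  split_ifs with h
  · exact hη
  · have hj := lt_of_le_of_ne (jointLaw_nonneg pX W a) (Ne.symm h)
    have hx : 0 < (pX a.1).toReal := by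
      refine lt_of_le_of_ne ENNReal.toReal_nonneg fun h0 => h ?_
      rw [jointLaw, ← h0, zero_mul]
    exact div_pos hj (mul_pos hx (hj.trans_le (jointLaw_le_blockLaw pX W a)))

lemma jointLaw_ofFn {s : ℕ} (x : Fin q) (y : Fin s → Fin q) :
    jointLaw pX W (x, List.ofFn y) = (pX x).toReal * ∏ l, (W x (y l)).toReal := by
  simp [jointLaw, List.map_ofFn, List.prod_ofFn]

lemma sum_jointLaw_ofFn (s : ℕ) (x : Fin q) :
    ∑ y : Fin s → Fin q, jointLaw pX W (x, List.ofFn y) = (pX x).toReal := by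
  simp_rw [jointLaw_ofFn, ← Finset.mul_sum]
  rw [← Fintype.prod_sum (fun (_ : Fin s) a => (W x a).toReal)]
  simp [pmf_toReal_sum]

lemma sum_blockLaw_ofFn (s : ℕ) : ∑ y : Fin s → Fin q, blockLaw pX W (List.ofFn y) = 1 := by
  simp_rw [blockLaw]
  rw [Finset.sum_comm]
  simp_rw [sum_jointLaw_ofFn, pmf_toReal_sum]

/-- Integrating over the entry law a function of the entry and the first `s` replicas. -/
lemma integral_entryLaw_take {s : ℕ} (hs : s ≤ smax) (h : Fin q × List (Fin q) → ℝ) :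
    ∫ e, h (e.1, (List.ofFn e.2).take s) ∂(entryLaw smax pX W) =
      ∑ x, ∑ y : Fin s → Fin q, jointLaw pX W (x, List.ofFn y) * h (x, List.ofFn y) := by
  rw [integral_entryLaw]
  refine Finset.sum_congr rfl fun x _ => ?_
  simp_rw [jointLaw_ofFn, mul_assoc, ← Finset.mul_sum]
  rw [sum_prod_take (pmf_toReal_sum (W x)) smax s hs fun b => h (x, b)]

lemma integral_ratio_le (pS : PMF (Fin (smax + 1))) {η : ℝ} (hη : 0 ≤ η) :
    ∫ t, ratio pX W η (letter t.1 (t.2.1.1, t.2.2.2))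
      ∂(pS.toMeasure.prod ((entryLaw smax pX W).prod (entryLaw smax pX W))) ≤ 1 + η := by
  rw [integral_prod _ Integrable.of_finite, integral_pmf]
  have key : ∀ s : Fin (smax + 1), ∫ e, ratio pX W η (letter s (e.1.1, e.2.2))
      ∂((entryLaw smax pX W).prod (entryLaw smax pX W)) ≤ 1 + η := by
    intro s
    rw [integral_prod _ Integrable.of_finite]
    have h1 : ∀ e : Fin q × (Fin smax → Fin q), ∫ e', ratio pX W η (letter s (e.1, e'.2))
        ∂(entryLaw smax pX W) = ∑ y : Fin s → Fin q, blockLaw pX W (List.ofFn y) *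
          ratio pX W η (e.1, List.ofFn y) := by
      intro e
      simp only [letter]
      rw [integral_entryLaw_take pX W (by omega) (fun a => ratio pX W η (e.1, a.2)),
        Finset.sum_comm]
      simp_rw [blockLaw, Finset.sum_mul]
    simp_rw [h1]
    rw [integral_entryLaw_take pX W (s := 0) (by omega) (fun a => ∑ y : Fin s → Fin q,
      blockLaw pX W (List.ofFn y) * ratio pX W η (a.1, List.ofFn y))]
    have h2 : ∀ x, ∀ y : Fin s → Fin q, (pX x).toReal * (blockLaw pX W (List.ofFn y) *
        ratio pX W η (x, List.ofFn y)) ≤ jointLaw pX W (x, List.ofFn y) +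
          (pX x).toReal * blockLaw pX W (List.ofFn y) * η := by
      intro x y
      unfold ratio
      have h3 : 0 ≤ (pX x).toReal * blockLaw pX W (List.ofFn y) :=
        mul_nonneg ENNReal.toReal_nonneg (blockLaw_nonneg pX W _)
      split_ifs with h
      · rw [h]; simp [mul_assoc]
      · rw [← mul_assoc]
        refine le_trans ?_ (le_add_of_nonneg_right (mul_nonneg h3 hη))
        rcases h3.eq_or_lt with h4 | h4
        · rw [← h4, zero_mul]; exact jointLaw_nonneg pX W _
        · rw [mul_div_cancel₀ _ h4.ne']
    simp only [jointLaw_ofFn, Finset.univ_unique, Finset.sum_singleton, Finset.univ_eq_empty,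
      Finset.prod_empty, mul_one]
    calc ∑ x, (pX x).toReal * ∑ y : Fin s → Fin q, blockLaw pX W (List.ofFn y) *
          ratio pX W η (x, List.ofFn y)
        ≤ ∑ x, ∑ y : Fin s → Fin q, (jointLaw pX W (x, List.ofFn y) +
          (pX x).toReal * blockLaw pX W (List.ofFn y) * η) := by
          refine Finset.sum_le_sum fun x _ => ?_
          rw [Finset.mul_sum]
          exact Finset.sum_le_sum fun y _ => h2 x y
      _ = 1 + η := by
          simp_rw [Finset.sum_add_distrib, sum_jointLaw_ofFn, ← Finset.sum_mul, ← Finset.mul_sum,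
            sum_blockLaw_ofFn, mul_one, pmf_toReal_sum, one_mul]
  refine (Finset.sum_le_sum fun s _ =>
    mul_le_mul_of_nonneg_left (key s) ENNReal.toReal_nonneg).trans_eq ?_
  rw [← Finset.sum_mul, pmf_toReal_sum, one_mul]

lemma integral_logb_ratio (pS : PMF (Fin (smax + 1))) (η : ℝ) :
    ∫ t, Real.logb 2 (ratio pX W η (letter t.1 t.2)) ∂(pS.toMeasure.prod (entryLaw smax pX W)) =
      condMutualInfo pX W pS := by
  rw [integral_prod _ Integrable.of_finite, integral_pmf, condMutualInfo]
  refine Finset.sum_congr rfl fun s _ => ?_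
  simp only [letter]
  rw [integral_entryLaw_take pX W (by omega) (fun a => Real.logb 2 (ratio pX W η a)), mutualInfo]
  simp_rw [← jointLaw_ofFn pX W, sum_jointLaw_ofFn]
  congr 1
  refine Finset.sum_congr rfl fun x _ => Finset.sum_congr rfl fun y _ => ?_
  by_cases h : jointLaw pX W (x, List.ofFn y) = 0
  · simp [h]
  · rw [ratio, if_neg h, blockLaw]

/-- If an entry and its replica are independent, the mutual information vanishes. -/
lemma condMutualInfo_eq_zero (pS : PMF (Fin (smax + 1)))
    (h : ∀ x y, (pX x).toReal * (W x y).toReal = (pX x).toReal * outLaw pX W y) :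
    condMutualInfo pX W pS = 0 := by
  rw [← integral_logb_ratio pX W pS 1]
  refine integral_eq_zero_of_ae (ae_of_all _ fun t => ?_)
  change Real.logb 2 (ratio pX W 1 (letter t.1 t.2)) = 0
  generalize letter t.1 t.2 = a
  obtain ⟨x, b⟩ := a
  have hj : ∀ x, jointLaw pX W (x, b) = (pX x).toReal * (b.map (outLaw pX W)).prod := by
    intro x
    rcases eq_or_ne (pX x).toReal 0 with h0 | h0
    · simp [jointLaw, h0]
    · have : (fun y => (W x y).toReal) = outLaw pX W := funext fun y => mul_left_cancel₀ h0 (h x y)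
      simp [jointLaw, this]
  have hb : blockLaw pX W b = (b.map (outLaw pX W)).prod := by
    simp_rw [blockLaw, hj, ← Finset.sum_mul, pmf_toReal_sum, one_mul]
  rw [ratio]
  split_ifs with h0
  · simp
  · rw [hb, ← hj, div_self h0, Real.logb_one]

end Ratio

/-! ### Bad events -/

section Events

variable {q smax m n L : ℕ} (pX : PMF (Fin q)) (W : Fin q → PMF (Fin q))
  (pS : PMF (Fin (smax + 1)))

lemma integral_entryLaw_mul (l : Fin smax) (a b : Fin q → ℝ) :
    ∫ e, a e.1 * b (e.2 l) ∂(entryLaw smax pX W) =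
      ∑ x, (pX x).toReal * a x * ∑ y, (W x y).toReal * b y := by
  rw [integral_entryLaw]
  refine Finset.sum_congr rfl fun x _ => ?_
  have h : ∑ z : Fin smax → Fin q, (∏ i, (W x (z i)).toReal) * b (z l) =
      ∑ y, (W x y).toReal * b y := by
    have h1 : ∀ z : Fin smax → Fin q, (∏ i, (W x (z i)).toReal) * b (z l) =
        ∏ i, ((W x (z i)).toReal * if i = l then b (z i) else 1) := by
      intro z
      rw [Finset.prod_mul_distrib, Finset.prod_ite_eq' Finset.univ l fun i => b (z i)]
      simp
    simp_rw [h1]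
    rw [← Fintype.prod_sum fun i y => (W x y).toReal * if i = l then b y else 1,
      Finset.prod_eq_single l]
    · simp
    · intro i _ hi
      simp [hi, pmf_toReal_sum]
    · simp
  rw [← h, Finset.mul_sum]
  exact Finset.sum_congr rfl fun z _ => by ring

open Classical in
lemma entryLaw_real_fst_snd (l : Fin smax) (A B : Set (Fin q)) :
    (entryLaw smax pX W).real {e | e.1 ∈ A ∧ e.2 l ∈ B} =
      ∑ x, (pX x).toReal * (if x ∈ A then 1 else 0) *
        ∑ y, (W x y).toReal * (if y ∈ B then 1 else 0) := by
  rw [← integral_indicator_one (Set.toFinite _).measurableSet,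
    ← integral_entryLaw_mul pX W l (fun x => if x ∈ A then 1 else 0)
      (fun y => if y ∈ B then 1 else 0)]
  refine integral_congr_ae (ae_of_all _ fun e => ?_)
  by_cases h1 : e.1 ∈ A <;> by_cases h2 : e.2 l ∈ B <;> simp [h1, h2]

lemma pi_entryLaw_real_pair (j : Fin n) (p : Fin n × Fin smax) (x y : Fin q) :
    (Measure.pi fun _ : Fin n => entryLaw smax pX W).real
      {e | (e j).1 = x ∧ (e p.1).2 p.2 = y} = pairLaw pX W j p.1 x y := by
  classical
  obtain ⟨j', l⟩ := p
  simp only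
  by_cases h : j' = j
  · subst h
    have hm := measurePreserving_eval (fun _ : Fin n => entryLaw smax pX W) j'
    have hp := hm.measureReal_preimage (s := {e | e.1 ∈ ({x} : Set (Fin q)) ∧ e.2 l ∈ ({y} : Set (Fin q))})
      (Set.toFinite _).measurableSet.nullMeasurableSet
    rw [entryLaw_real_fst_snd] at hp
    rw [pairLaw, if_pos rfl]
    refine Eq.trans ?_ (hp.trans ?_)
    · rfl
    · simp
  · have hm := measurePreserving_eval_pair (entryLaw smax pX W) (Ne.symm h)
    have hp := hm.measureReal_preimage
      (s := {e | e.1 ∈ ({x} : Set (Fin q)) ∧ e.2 l ∈ (Set.univ : Set (Fin q))} ×ˢ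
        {e | e.1 ∈ (Set.univ : Set (Fin q)) ∧ e.2 l ∈ ({y} : Set (Fin q))})
      (Set.toFinite _).measurableSet.nullMeasurableSet
    rw [measureReal_prod_prod, entryLaw_real_fst_snd, entryLaw_real_fst_snd] at hp
    rw [pairLaw, if_neg h]
    refine Eq.trans ?_ (hp.trans ?_)
    · congr 1
      ext e
      simp
    · simp [pmf_toReal_sum, outLaw]

/-- The rows with entry `x` at `j` and potential replica `y` at `p`. -/
def pairEvent (c : Fin n × (Fin n × Fin smax) × Fin q × Fin q) :
    Set (Fin n → Fin q × (Fin smax → Fin q)) :=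
  {e | (e c.1).1 = c.2.2.1 ∧ (e c.2.1.1).2 c.2.1.2 = c.2.2.2}

/-- Some frequency of the seeds deviates from its probability. -/
def BadSeeds (G : NoisyArray q smax L n) : Prop :=
  ¬ ∀ j p x y, |arrayFreq G j p x y - pairLaw pX W j p.1 x y| ≤ seedTol n L

open Classical in
lemma BadSeeds.exists_deviation (hL : 0 < L) {G : NoisyArray q smax L n} (h : BadSeeds pX W G) :
    ∃ c, L * seedTol n L < |((Finset.univ.filter fun r => G r ∈ pairEvent c).card : ℝ) -
      L * (Measure.pi fun _ : Fin n => entryLaw smax pX W).real (pairEvent c)| := by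
  have hL' : (0 : ℝ) < L := by exact_mod_cast hL
  simp only [BadSeeds, not_forall, not_le] at h
  obtain ⟨j, p, x, y, h⟩ := h
  refine ⟨(j, p, x, y), ?_⟩
  have he : (Measure.pi fun _ : Fin n => entryLaw smax pX W).real (pairEvent (j, p, x, y)) =
    pairLaw pX W j p.1 x y := pi_entryLaw_real_pair pX W j p x y
  have hf : ((Finset.univ.filter fun r => G r ∈ pairEvent (j, p, x, y)).card : ℝ) =
      L * arrayFreq G j p x y := by
    rw [arrayFreq, mul_div_cancel₀ _ hL'.ne']
    congr 2
    ext r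
    rw [Finset.mem_filter, Finset.mem_filter]
    rfl
  rw [he, hf, ← mul_sub, abs_mul, abs_of_pos hL']
  exact mul_lt_mul_of_pos_left h hL'

lemma measure_badSeeds (hL : 0 < L) :
    (Measure.pi fun _ : Fin L => Measure.pi fun _ : Fin n => entryLaw smax pX W).real
      {G | BadSeeds pX W G} ≤
      (n * (n * smax * (q * q)) : ℝ) * (2 * Real.exp (-2 * (L * seedTol n L) ^ 2 / L)) := by
  classical
  refine (measureReal_mono (fun G hG => Set.mem_iUnion.2 (BadSeeds.exists_deviation pX W hL hG))
    (measure_ne_top _ _)).trans ((measureReal_iUnion_fintype_le _).trans ?_)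
  refine (Finset.sum_le_card_nsmul _ _ _ fun c _ =>
    pi_count_deviation _ L (Set.toFinite (pairEvent c)).measurableSet
      (mul_nonneg (Nat.cast_nonneg L) (Real.sqrt_nonneg _))).trans (le_of_eq ?_)
  rw [nsmul_eq_mul]
  congr 1
  simp

/-- The letter of a column, from its number of repetitions, its entry and its replicas. -/
def columnLetter (t : Fin (smax + 1) × (Fin q × (Fin smax → Fin q))) : Fin q × List (Fin q) :=
  letter t.1 t.2

/-- The columns formed by the entries of one row and the potential replicas of another one. -/
def mixedColumns (S : Fin n → Fin (smax + 1)) (u v : Fin n → Fin q × (Fin smax → Fin q)) :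
    Fin n → Fin (smax + 1) × (Fin q × (Fin smax → Fin q)) :=
  fun j => (S j, ((u j).1, (v j).2))

/-- The letter counts of a sequence of columns are within `K` of their expectations. -/
def Typical (K : ℝ) (t : Fin n → Fin (smax + 1) × (Fin q × (Fin smax → Fin q))) : Prop :=
  ∀ a, |(valueCount columnLetter t a : ℝ) -
    n * (pS.toMeasure.prod (entryLaw smax pX W)).real (columnLetter ⁻¹' {a})| ≤ K

/-- The set of all letters. -/
noncomputable def letters (q smax : ℕ) : Finset (Fin q × List (Fin q)) :=
  values (columnLetter (q := q) (smax := smax))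

lemma measure_not_typical {K : ℝ} (hK : 0 ≤ K) :
    ((Measure.pi fun _ : Fin n => pS.toMeasure).prod
      (Measure.pi fun _ : Fin n => entryLaw smax pX W)).real
      {c | ¬ Typical pX W pS K (mixedColumns c.1 c.2 c.2)} ≤
      (letters q smax).card * (2 * Real.exp (-2 * K ^ 2 / n)) := by
  have hm := measurePreserving_zip pS.toMeasure (entryLaw smax pX W) n
  have hp := hm.measureReal_preimage (s := {t | ¬ Typical pX W pS K t})
      (Set.toFinite _).measurableSet.nullMeasurableSet
  exact (Eq.trans rfl hp).trans_le (measure_valueCount_deviation _ columnLetter hK)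

lemma measure_typical_mixed {K η : ℝ} (hη : 0 < η) :
    ((Measure.pi fun _ : Fin n => pS.toMeasure).prod
      ((Measure.pi fun _ : Fin n => entryLaw smax pX W).prod
        (Measure.pi fun _ : Fin n => entryLaw smax pX W))).real
      {c | Typical pX W pS K (mixedColumns c.1 c.2.1 c.2.2)} ≤
      (1 + η) ^ n / 2 ^ (n * condMutualInfo pX W pS -
        K * ∑ a ∈ letters q smax, |Real.logb 2 (ratio pX W η a)|) := by
  set E := entryLaw smax pX W
  set g : Fin (smax + 1) × (Fin q × (Fin smax → Fin q)) × (Fin q × (Fin smax → Fin q)) → ℝ :=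
    fun t => ratio pX W η (letter t.1 (t.2.1.1, t.2.2.2)) with hg
  set c := (2 : ℝ) ^ (n * condMutualInfo pX W pS -
        K * ∑ a ∈ letters q smax, |Real.logb 2 (ratio pX W η a)|) with hc
  have hc0 : 0 < c := Real.rpow_pos_of_pos two_pos _
  have hm : MeasurePreserving (fun (p : (Fin n → Fin (smax + 1)) ×
      (Fin n → Fin q × (Fin smax → Fin q)) × (Fin n → Fin q × (Fin smax → Fin q))) (j : Fin n) =>
        (p.1 j, (p.2.1 j, p.2.2 j)))
      ((Measure.pi fun _ => pS.toMeasure).prod ((Measure.pi fun _ => E).prod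
        (Measure.pi fun _ => E))) (Measure.pi fun _ => pS.toMeasure.prod (E.prod E)) :=
    (measurePreserving_zip pS.toMeasure (E.prod E) n).comp
      ((MeasurePreserving.id _).prod (measurePreserving_zip E E n))
  have hp := hm.measureReal_preimage (s := {t | c ≤ ∏ j, g (t j)})
      (Set.toFinite _).measurableSet.nullMeasurableSet
  have hle := pi_prod_ge_le (pS.toMeasure.prod (E.prod E)) n (g := g)
    (fun t => (ratio_pos pX W hη _).le) hc0
  rw [← hp] at hle
  refine le_trans (measureReal_mono ?_ (measure_ne_top _ _)) (hle.trans ?_)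
  · intro p ht
    have h := sum_ge_of_valueCount (pS.toMeasure.prod E) columnLetter
      (fun a => Real.logb 2 (ratio pX W η a)) (mixedColumns p.1 p.2.1 p.2.2) ht
    have h3 : ∫ x, Real.logb 2 (ratio pX W η (columnLetter x)) ∂(pS.toMeasure.prod E) =
      condMutualInfo pX W pS := integral_logb_ratio pX W pS η
    rw [h3] at h
    change c ≤ ∏ j, g _
    have h4 : ∀ j, g (p.1 j, (p.2.1 j, p.2.2 j)) = (2 : ℝ) ^ Real.logb 2
        (ratio pX W η (columnLetter (mixedColumns p.1 p.2.1 p.2.2 j))) := by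
      intro j
      rw [Real.rpow_logb two_pos (by norm_num) (ratio_pos pX W hη _)]
      rfl
    rw [Finset.prod_congr rfl fun j _ => h4 j, ← Real.rpow_sum_of_pos two_pos, hc]
    exact Real.rpow_le_rpow_of_exponent_le one_le_two h
  · refine div_le_div_of_nonneg_right (pow_le_pow_left₀ ?_ ?_ n) hc0.le
    · exact integral_nonneg fun t => (ratio_pos pX W hη _).le
    · exact integral_ratio_le pX W pS hη.le

end Events

/-! ### Error probability of the estimator -/

section ErrorBound

variable {q smax m n L : ℕ} (pX : PMF (Fin q)) (W : Fin q → PMF (Fin q))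
  (pS : PMF (Fin (smax + 1)))

lemma letterCount_eq_valueCount {a b : ℕ} {G1 : Fin L → Fin n → Fin q} {G2 : Fin L → List (Fin q)}
    {S : Fin n → Fin (smax + 1)}
    (h : ∀ j k (hk : k < (releasedIndices S).length),
      Linked G1 G2 j k ↔ ((releasedIndices S)[k]).1 = j)
    (A : NoisyArray q smax a n) (A' : NoisyArray q smax b n) (i : Fin a) (k : Fin b)
    (c : Fin q × List (Fin q)) :
    letterCount G1 G2 (clean A i) (repeated S A' k) c =
      valueCount columnLetter (mixedColumns S (A i) (A' k)) c := by
  unfold letterCount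
  simp only [block_repeated S h]
  rfl

/-- The estimator is right at the row `J` unless a frequency of the seeds deviates, or the columns
of the first seed row or of the row `J` are not typical, or the row `J` looks matched to another
row. -/
lemma estimator_apply {σ : Equiv.Perm (Fin m)} {J : Fin m} {S : Fin n → Fin (smax + 1)}
    {D : NoisyArray q smax m n} {G : NoisyArray q smax L n} {r : Fin L} (hr : r.val = 0)
    (hlink : ∀ j k (hk : k < (releasedIndices S).length),
      Linked (clean G) (repeated S G) j k ↔ ((releasedIndices S)[k]).1 = j)
    (hseed : Typical pX W pS (countTol n / 2) (mixedColumns S (G r) (G r)))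
    (htrue : Typical pX W pS (countTol n / 2) (mixedColumns S (D J) (D J)))
    (hwrong : ∀ i, i ≠ J → ¬ Typical pX W pS (3 / 2 * countTol n) (mixedColumns S (D J) (D i)) ∧
      ¬ Typical pX W pS (3 / 2 * countTol n) (mixedColumns S (D i) (D J))) :
    estimator q m n L (clean D) (fun k => repeated S D (σ.symm k)) (clean G) (repeated S G) J =
      σ J := by
  have hsim : ∀ i k, Similar (clean D) (fun k => repeated S D (σ.symm k)) (clean G) (repeated S G)
      i k → Typical pX W pS (3 / 2 * countTol n) (mixedColumns S (D i) (D (σ.symm k))) := by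
    rintro i k ⟨r', hr', h⟩ a
    obtain rfl : r' = r := Fin.ext (hr'.trans hr.symm)
    have h1 := h a
    rw [letterCount_eq_valueCount hlink, letterCount_eq_valueCount hlink] at h1
    have h2 := abs_add_le _ _ |>.trans (add_le_add h1 (hseed a))
    rw [sub_add_sub_cancel] at h2
    linarith
  refine (exists_perm_of_unique (Similar (clean D) (fun k => repeated S D (σ.symm k)) (clean G)
    (repeated S G))).choose_spec J (σ J) ⟨r, hr, fun a => ?_⟩ (fun i hi => ?_) (fun k hk => ?_)
  · simp only [Equiv.symm_apply_apply]
    rw [letterCount_eq_valueCount hlink, letterCount_eq_valueCount hlink]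
    have h1 := htrue a
    have h2 := hseed a
    rw [abs_sub_comm] at h2
    have h3 := abs_add_le _ _ |>.trans (add_le_add h1 h2)
    rw [sub_add_sub_cancel] at h3
    linarith
  · by_contra hne
    have := hsim i _ hi
    rw [Equiv.symm_apply_apply] at this
    exact (hwrong i hne).2 this
  · by_contra hne
    exact (hwrong (σ.symm k) fun h => hne (by rw [← h, Equiv.apply_symm_apply])).1 (hsim J k hk)

/-- The law of the repetition pattern, the database and the seeds. -/
noncomputable def dataLaw (m n L : ℕ) : Measure ((Fin n → Fin (smax + 1)) ×
    NoisyArray q smax m n × NoisyArray q smax L n) :=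
  (Measure.pi (fun _ : Fin n => pS.toMeasure)).prod <|
  (Measure.pi (fun _ : Fin m => Measure.pi (fun _ : Fin n => entryLaw smax pX W))).prod <|
  (Measure.pi (fun _ : Fin L => Measure.pi (fun _ : Fin n => entryLaw smax pX W)))

instance : IsProbabilityMeasure (dataLaw pX W pS m n L) := by unfold dataLaw; infer_instance

lemma modelLaw_real_le (hm : 0 < m) (s : Set (Outcome q smax m n L)) {c : ℝ}
    (B : Fin m → Set ((Fin n → Fin (smax + 1)) × NoisyArray q smax m n × NoisyArray q smax L n))
    (hs : ∀ o ∈ s, o.2.2 ∈ B o.2.1) (hB : ∀ J, (dataLaw pX W pS m n L).real (B J) ≤ c) :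
    (modelLaw pX W pS m n L).real s ≤ c := by
  have : Nonempty (Fin m) := ⟨⟨0, hm⟩⟩
  have : IsProbabilityMeasure (uniformOn (Set.univ : Set (Fin m))) :=
    isProbabilityMeasure_uniformOn Set.finite_univ Set.univ_nonempty
  have : IsProbabilityMeasure (uniformOn (Set.univ : Set (Equiv.Perm (Fin m)))) :=
    isProbabilityMeasure_uniformOn Set.finite_univ Set.univ_nonempty
  have hc : 0 ≤ c := measureReal_nonneg.trans (hB ⟨0, hm⟩)
  refine ENNReal.toReal_le_of_le_ofReal hc ?_
  let B' : Set (Fin m × _) := {p | p.2 ∈ B p.1}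
  have h1 : modelLaw pX W pS m n L s ≤ ((uniformOn (Set.univ : Set (Equiv.Perm (Fin m)))).prod
      ((uniformOn (Set.univ : Set (Fin m))).prod (dataLaw pX W pS m n L))) (Set.univ ×ˢ B') :=
    measure_mono fun o ho => ⟨trivial, hs o ho⟩
  rw [Measure.prod_prod, measure_univ, one_mul,
    Measure.prod_apply (Set.toFinite B').measurableSet] at h1
  refine h1.trans ((lintegral_mono (g := fun _ => ENNReal.ofReal c) fun J => ?_).trans (by simp))
  rw [ENNReal.le_ofReal_iff_toReal_le (measure_ne_top _ _) hc]
  exact hB J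

/-- Non-asymptotic bound for the error probability of the estimator. -/
lemma errorProb_estimator_le (hm : 0 < m) (hL : 0 < L) (hδ : seedTol n L ≤ 1)
    (hd : ∃ x y, 2 * ((1 + q : ℝ) ^ 2 * seedTol n L) <
      |(pX x).toReal * (W x y).toReal - (pX x).toReal * outLaw pX W y|) {η : ℝ} (hη : 0 < η) :
    errorProb (estimator q) pX W pS m n L ≤
      (n * (n * smax * (q * q)) : ℝ) * (2 * Real.exp (-2 * (L * seedTol n L) ^ 2 / L)) +
      2 * ((letters q smax).card * (2 * Real.exp (-2 * (countTol n / 2) ^ 2 / n))) +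
      2 * (m * ((1 + η) ^ n / 2 ^ (n * condMutualInfo pX W pS -
        3 / 2 * countTol n * ∑ a ∈ letters q smax, |Real.logb 2 (ratio pX W η a)|))) := by
  have hK : 0 ≤ countTol n / 2 := div_nonneg (Real.sqrt_nonneg _) zero_le_two
  set c1 := (n * (n * smax * (q * q)) : ℝ) * (2 * Real.exp (-2 * (L * seedTol n L) ^ 2 / L))
    with hc1
  set c2 := (letters q smax).card * (2 * Real.exp (-2 * (countTol n / 2) ^ 2 / n)) with hc2
  set c3 := (1 + η) ^ n / 2 ^ (n * condMutualInfo pX W pS -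
    3 / 2 * countTol n * ∑ a ∈ letters q smax, |Real.logb 2 (ratio pX W η a)|) with hc3
  have hc3' : 0 ≤ c3 := by positivity
  let r : Fin L := ⟨0, hL⟩
  let B1 : Set ((Fin n → Fin (smax + 1)) × NoisyArray q smax m n × NoisyArray q smax L n) :=
    {o | BadSeeds pX W o.2.2}
  let B2 : Set ((Fin n → Fin (smax + 1)) × NoisyArray q smax m n × NoisyArray q smax L n) :=
    {o | ¬ Typical pX W pS (countTol n / 2) (mixedColumns o.1 (o.2.2 r) (o.2.2 r))}
  let B3 : Fin m → Set ((Fin n → Fin (smax + 1)) × NoisyArray q smax m n × NoisyArray q smax L n) :=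
    fun J => {o | ¬ Typical pX W pS (countTol n / 2) (mixedColumns o.1 (o.2.1 J) (o.2.1 J))}
  let B4 : Fin m → Fin m →
      Set ((Fin n → Fin (smax + 1)) × NoisyArray q smax m n × NoisyArray q smax L n) :=
    fun i k => {o | i ≠ k ∧
      Typical pX W pS (3 / 2 * countTol n) (mixedColumns o.1 (o.2.1 i) (o.2.1 k))}
  have h1 : (dataLaw pX W pS m n L).real B1 ≤ c1 := by
    have hmp : MeasurePreserving (fun o : (Fin n → Fin (smax + 1)) × NoisyArray q smax m n ×
        NoisyArray q smax L n => o.2.2) (dataLaw pX W pS m n L) (Measure.pi fun _ : Fin L =>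
          Measure.pi fun _ : Fin n => entryLaw smax pX W) :=
      measurePreserving_snd.comp measurePreserving_snd
    have hp := hmp.measureReal_preimage (s := {G | BadSeeds pX W G})
      (Set.toFinite _).measurableSet.nullMeasurableSet
    exact (Eq.trans rfl hp).trans_le (measure_badSeeds pX W hL)
  have h2 : (dataLaw pX W pS m n L).real B2 ≤ c2 := by
    have hmp : MeasurePreserving (fun o : (Fin n → Fin (smax + 1)) × NoisyArray q smax m n ×
        NoisyArray q smax L n => (o.1, o.2.2 r)) (dataLaw pX W pS m n L)
        ((Measure.pi fun _ : Fin n => pS.toMeasure).prod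
          (Measure.pi fun _ : Fin n => entryLaw smax pX W)) :=
      (MeasurePreserving.id _).prod ((measurePreserving_eval _ r).comp measurePreserving_snd)
    have hp := hmp.measureReal_preimage
      (s := {c | ¬ Typical pX W pS (countTol n / 2) (mixedColumns c.1 c.2 c.2)})
      (Set.toFinite _).measurableSet.nullMeasurableSet
    exact (Eq.trans rfl hp).trans_le (measure_not_typical pX W pS hK)
  have h3 : ∀ J, (dataLaw pX W pS m n L).real (B3 J) ≤ c2 := by
    intro J
    have hmp : MeasurePreserving (fun o : (Fin n → Fin (smax + 1)) × NoisyArray q smax m n ×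
        NoisyArray q smax L n => (o.1, o.2.1 J)) (dataLaw pX W pS m n L)
        ((Measure.pi fun _ : Fin n => pS.toMeasure).prod
          (Measure.pi fun _ : Fin n => entryLaw smax pX W)) :=
      (MeasurePreserving.id _).prod ((measurePreserving_eval _ J).comp measurePreserving_fst)
    have hp := hmp.measureReal_preimage
      (s := {c | ¬ Typical pX W pS (countTol n / 2) (mixedColumns c.1 c.2 c.2)})
      (Set.toFinite _).measurableSet.nullMeasurableSet
    exact (Eq.trans rfl hp).trans_le (measure_not_typical pX W pS hK)
  have h4 : ∀ i k, (dataLaw pX W pS m n L).real (B4 i k) ≤ c3 := by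
    intro i k
    by_cases hik : i = k
    · have : B4 i k = ∅ := by
        ext o; simp [B4, hik]
      rw [this, measureReal_empty]; exact hc3'
    have hmp : MeasurePreserving (fun o : (Fin n → Fin (smax + 1)) × NoisyArray q smax m n ×
        NoisyArray q smax L n => (o.1, (o.2.1 i, o.2.1 k))) (dataLaw pX W pS m n L)
        ((Measure.pi fun _ : Fin n => pS.toMeasure).prod
          ((Measure.pi fun _ : Fin n => entryLaw smax pX W).prod
            (Measure.pi fun _ : Fin n => entryLaw smax pX W))) :=
      (MeasurePreserving.id _).prod ((measurePreserving_eval_pair _ hik).comp measurePreserving_fst)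
    have hp := hmp.measureReal_preimage
      (s := {c | Typical pX W pS (3 / 2 * countTol n) (mixedColumns c.1 c.2.1 c.2.2)})
      (Set.toFinite _).measurableSet.nullMeasurableSet
    refine le_trans (measureReal_mono (fun o ho => ho.2) (measure_ne_top _ _))
      ((Eq.trans rfl hp).trans_le (measure_typical_mixed pX W pS hη))
  refine modelLaw_real_le pX W pS hm _
    (fun J => ((B1 ∪ (B2 ∪ B3 J)) ∪ ((⋃ i, B4 J i) ∪ ⋃ i, B4 i J))) ?_ fun J => ?_
  · rintro ⟨σ, J, S, D, G⟩ ho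
    by_contra hn
    simp only [Set.mem_union, not_or, Set.mem_iUnion, not_exists] at hn
    obtain ⟨⟨hn1, hn2, hn3⟩, hn4, hn5⟩ := hn
    refine ho (estimator_apply pX W pS (r := r) rfl (linked_iff hδ (not_not.1 hn1) hd)
      (not_not.1 hn2) (not_not.1 hn3) fun i hi => ⟨fun h => hn4 i ⟨hi.symm, h⟩,
        fun h => hn5 i ⟨hi, h⟩⟩)
  · have h5 : (dataLaw pX W pS m n L).real (⋃ i, B4 J i) ≤ m * c3 :=
      (measureReal_iUnion_fintype_le _).trans ((Finset.sum_le_card_nsmul _ _ _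
        fun i _ => h4 J i).trans (by simp))
    have h6 : (dataLaw pX W pS m n L).real (⋃ i, B4 i J) ≤ m * c3 :=
      (measureReal_iUnion_fintype_le _).trans ((Finset.sum_le_card_nsmul _ _ _
        fun i _ => h4 i J).trans (by simp))
    have h7 := measureReal_union_le (μ := dataLaw pX W pS m n L) (B1 ∪ (B2 ∪ B3 J))
      ((⋃ i, B4 J i) ∪ ⋃ i, B4 i J)
    have h8 := measureReal_union_le (μ := dataLaw pX W pS m n L) B1 (B2 ∪ B3 J)
    have h9 := measureReal_union_le (μ := dataLaw pX W pS m n L) B2 (B3 J)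
    have h10 := measureReal_union_le (μ := dataLaw pX W pS m n L) (⋃ i, B4 J i) (⋃ i, B4 i J)
    have h3J := h3 J
    linarith

end ErrorBound

/-! ### Asymptotics -/

section Asymptotic

lemma tendsto_log_div {L : ℕ → ℕ}
    (h : (fun n : ℕ => Real.logb 2 n) =o[atTop] (fun n : ℕ => (L n : ℝ))) :
    Tendsto (fun n : ℕ => Real.log n / L n) atTop (𝓝 0) := by
  have h1 := h.tendsto_div_nhds_zero.const_mul (Real.log 2)
  rw [mul_zero] at h1
  refine h1.congr fun n => ?_
  rw [Real.logb, ← mul_div_assoc, mul_div_cancel₀ _ (Real.log_pos one_lt_two).ne']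

lemma tendsto_seedTol {L : ℕ → ℕ} (h : Tendsto (fun n : ℕ => Real.log n / L n) atTop (𝓝 0)) :
    Tendsto (fun n => seedTol n (L n)) atTop (𝓝 0) := by
  simpa [seedTol] using h.sqrt.sqrt

lemma exp_seedTol_le {n L : ℕ} (hn : 0 < n) (hL : 0 < L) (h : Real.log n / L ≤ 1 / 4) :
    Real.exp (-2 * (L * seedTol n L) ^ 2 / L) ≤ ((n : ℝ) ^ 4)⁻¹ := by
  have hL' : (0 : ℝ) < L := by exact_mod_cast hL
  have hn' : (0 : ℝ) < n := by exact_mod_cast hn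
  have hu : 0 ≤ Real.log n / L := div_nonneg (Real.log_natCast_nonneg n) hL'.le
  have hs : √(Real.log n / L) ≤ 1 / 2 := by
    rw [Real.sqrt_le_left (by norm_num)]
    linarith
  have hlog : Real.log n = L * (√(Real.log n / L) * √(Real.log n / L)) := by
    rw [Real.mul_self_sqrt hu, mul_div_cancel₀ _ hL'.ne']
  have he : -2 * (L * seedTol n L) ^ 2 / L = -2 * (L * √(Real.log n / L)) := by
    rw [mul_pow, seedTol, Real.sq_sqrt (Real.sqrt_nonneg _)]
    field_simp
  have h4 : ((n : ℝ) ^ 4)⁻¹ = Real.exp (-(4 * Real.log n)) := by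
    rw [Real.exp_neg, ← Real.exp_log (pow_pos hn' 4), Real.log_pow]
    norm_num
  rw [he, h4, Real.exp_le_exp]
  have := mul_le_mul_of_nonneg_left hs (mul_nonneg hL'.le (Real.sqrt_nonneg (Real.log n / L)))
  nlinarith

lemma tendsto_exp_countTol :
    Tendsto (fun n : ℕ => Real.exp (-2 * (countTol n / 2) ^ 2 / n)) atTop (𝓝 0) := by
  have h : Tendsto (fun n : ℕ => √(n : ℝ) / 2) atTop atTop :=
    (Real.tendsto_sqrt_atTop.comp tendsto_natCast_atTop_atTop).atTop_div_const two_pos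
  refine (Real.tendsto_exp_neg_atTop_nhds_zero.comp h).congr' ?_
  filter_upwards [eventually_gt_atTop 0] with n hn
  have hn' : (0 : ℝ) < n := by exact_mod_cast hn
  simp only [Function.comp_apply]
  rw [div_pow, countTol, Real.sq_sqrt (by positivity)]
  congr 1
  field_simp

lemma eventually_countTol_le {ε : ℝ} (hε : 0 < ε) : ∀ᶠ n : ℕ in atTop, countTol n ≤ n * ε := by
  have h := (Real.tendsto_sqrt_atTop.comp tendsto_natCast_atTop_atTop).eventually_ge_atTop
    (1 / ε ^ 2)
  filter_upwards [h] with n hn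
  simp only [Function.comp_apply] at hn
  rw [div_le_iff₀ (by positivity)] at hn
  have hs : √(n : ℝ) * √n = n := Real.mul_self_sqrt (Nat.cast_nonneg n)
  rw [countTol, Real.sqrt_le_left (by positivity)]
  have := mul_le_mul_of_nonneg_left hn (mul_nonneg (Nat.cast_nonneg n) (Real.sqrt_nonneg (n : ℝ)))
  calc (n : ℝ) * √n = n * √n * 1 := (mul_one _).symm
    _ ≤ n * √n * (√n * ε ^ 2) := this
    _ = (n * ε) ^ 2 := by rw [← mul_assoc, mul_assoc (n : ℝ), hs]; ring

lemma tendsto_rate_bound {m : ℕ → ℕ} {R I C : ℝ} (hm : ∀ n, 0 < m n) (hC : 0 ≤ C)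
    (hR : Tendsto (fun n : ℕ => (1 / (n : ℝ)) * Real.logb 2 (m n)) atTop (𝓝 R)) {g : ℝ}
    (hg : 0 < g) (hI : I = R + 4 * g) :
    (∀ᶠ n : ℕ in atTop, (m n : ℝ) * (((2 : ℝ) ^ g) ^ n /
      2 ^ (n * I - 3 / 2 * countTol n * C)) ≤ ((2 : ℝ) ^ (-g)) ^ n) := by
  filter_upwards [eventually_gt_atTop 0, hR.eventually_lt_const (show R < R + g by linarith),
    eventually_countTol_le (show 0 < g / (3 / 2 * (C + 1)) by positivity)] with n hn h1 h2
  have hn' : (0 : ℝ) < n := by exact_mod_cast hn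
  have hm' : (0 : ℝ) < m n := by exact_mod_cast hm n
  have h3 : Real.logb 2 (m n) ≤ n * (R + g) := by
    rw [one_div_mul_eq_div, div_lt_iff₀ hn'] at h1
    linarith
  have h4 : 3 / 2 * countTol n * C ≤ n * g := by
    rw [← mul_div_assoc, le_div_iff₀ (by positivity)] at h2
    have : 0 ≤ countTol n := Real.sqrt_nonneg _
    nlinarith
  rw [← Real.rpow_natCast, ← Real.rpow_natCast, ← Real.rpow_mul zero_le_two,
    ← Real.rpow_mul zero_le_two, ← Real.rpow_sub two_pos]
  nth_rewrite 1 [← Real.rpow_logb two_pos (by norm_num) hm']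
  rw [← Real.rpow_add two_pos]
  refine Real.rpow_le_rpow_of_exponent_le one_le_two ?_
  subst hI
  linarith

end Asymptotic

end DBMatch

theorem theorem1 (q smax : ℕ) :
    ∃ est : DBMatch.Estimator q,
      ∀ (pX : PMF (Fin q)) (W : Fin q → PMF (Fin q)) (pS : PMF (Fin (smax + 1)))
        (R : ℝ) (m L : ℕ → ℕ),
        (∀ n, 0 < m n) →
        Tendsto (fun n : ℕ => (1 / (n : ℝ)) * Real.logb 2 (m n)) atTop (𝓝 R) →
        (fun n : ℕ => Real.logb 2 n) =o[atTop] (fun n : ℕ => (L n : ℝ)) →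
        R < DBMatch.condMutualInfo pX W pS →
        Tendsto (fun n : ℕ => DBMatch.errorProb est pX W pS (m n) n (L n)) atTop (𝓝 0) := by
  open DBMatch in
  refine ⟨estimator q, fun pX W pS R m L hm hR hL hI => ?_⟩
  have hR0 : 0 ≤ R := ge_of_tendsto' hR fun n => mul_nonneg (by positivity)
    (Real.logb_nonneg one_lt_two (by exact_mod_cast hm n))
  obtain ⟨x, y, hxy⟩ : ∃ x y,
      (pX x).toReal * (W x y).toReal ≠ (pX x).toReal * outLaw pX W y := by
    by_contra! h
    rw [condMutualInfo_eq_zero pX W pS h] at hI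
    linarith
  have hpos := abs_pos.2 (sub_ne_zero.2 hxy)
  set g := (condMutualInfo pX W pS - R) / 4 with hg
  have hg0 : 0 < g := by linarith
  set η := (2 : ℝ) ^ g - 1 with hη
  have hη0 : 0 < η := sub_pos.2 (Real.one_lt_rpow one_lt_two hg0)
  set C := ∑ a ∈ letters q smax, |Real.logb 2 (ratio pX W η a)| with hC
  have hlog := tendsto_log_div hL
  have htol := tendsto_seedTol hlog
  have htol' := htol.const_mul (2 * (1 + q : ℝ) ^ 2)
  rw [mul_zero] at htol'
  have hlim : Tendsto (fun n : ℕ => 2 * (smax * (q * q)) * (1 / (n : ℝ)) +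
      2 * ((letters q smax).card * (2 * Real.exp (-2 * (countTol n / 2) ^ 2 / n))) +
      2 * ((2 : ℝ) ^ (-g)) ^ n) atTop (𝓝 0) := by
    have h1 := tendsto_one_div_atTop_nhds_zero_nat (𝕜 := ℝ).const_mul
      (2 * (smax * (q * q) : ℝ))
    have h2 := ((tendsto_exp_countTol.const_mul 2).const_mul
      ((letters q smax).card : ℝ)).const_mul 2
    have h3 := (tendsto_pow_atTop_nhds_zero_of_lt_one (r := (2 : ℝ) ^ (-g)) (by positivity)
      (Real.rpow_lt_one_of_one_lt_of_neg one_lt_two (by linarith))).const_mul 2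
    simpa using (h1.add h2).add h3
  refine squeeze_zero' (Eventually.of_forall fun n => measureReal_nonneg) ?_ hlim
  filter_upwards [eventually_gt_atTop 1, htol.eventually_le_const one_pos,
    htol'.eventually_lt_const hpos,
    hlog.eventually_le_const (show (0 : ℝ) < 1 / 4 by norm_num),
    hL.bound one_pos,
    tendsto_rate_bound (I := condMutualInfo pX W pS) (C := C) hm
      (Finset.sum_nonneg fun _ _ => abs_nonneg _) hR hg0 (by rw [hg]; ring)]
    with n hn h1 h2 h3 h4 h5
  have hn' : (1 : ℝ) < n := by exact_mod_cast hn
  have hLn : 0 < L n := by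
    rw [Nat.pos_iff_ne_zero]
    intro h0
    rw [h0, Nat.cast_zero, norm_zero, mul_zero, norm_le_zero_iff] at h4
    exact (Real.logb_pos one_lt_two hn').ne' h4
  have hmain := errorProb_estimator_le pX W pS (hm n) hLn h1
    ⟨x, y, by rw [← mul_assoc]; exact h2⟩ hη0
  have h1η : 1 + η = (2 : ℝ) ^ g := by rw [hη]; ring
  rw [← hC, h1η] at hmain
  have hterm : (n * (n * smax * (q * q)) : ℝ) * (2 * Real.exp (-2 * (L n * seedTol n (L n)) ^ 2 / L n))
      ≤ 2 * (smax * (q * q)) * (1 / (n : ℝ)) := by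
    have h6 := exp_seedTol_le (by omega) hLn h3
    have h7 : (n : ℝ) ^ 2 * ((n : ℝ) ^ 4)⁻¹ ≤ 1 / n := by
      rw [← div_eq_mul_inv, div_le_div_iff₀ (by positivity) (by positivity)]
      have : (n : ℝ) ^ 3 ≤ (n : ℝ) ^ 4 := pow_le_pow_right₀ hn'.le (by norm_num)
      linarith
    calc _ = 2 * (smax * (q * q)) *
          ((n : ℝ) ^ 2 * Real.exp (-2 * (L n * seedTol n (L n)) ^ 2 / L n)) := by ring
      _ ≤ _ := by
        refine mul_le_mul_of_nonneg_left (le_trans ?_ h7) (by positivity)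
        exact mul_le_mul_of_nonneg_left h6 (by positivity)
  linarith
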